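/- Let $K\subset\overline{\mathbb Q}$ be a number field, and let $F(X_1,\dots,X_N)$ be a homogeneous polynomial of degree $M\ge 1$ in $N\ge 2$ variables with coefficients in $K$ that does not vanish at any of the standard basis vectors $\boldsymbol e_1,\dots,\boldsymbol e_N$. Then there exists $\boldsymbol z=(z_1,\dots,z_N)\in\overline{\mathbb Q}^N$ with $[K(z_1,\dots,z_N):K]\le M$ such that $F(\boldsymbol z)=0$, $z_i\ne 0$ for all $1\le i\le N$, and $$H(\boldsymbol z)\le C_2(N,M)\,H(F)^{1/M},\qquad C_2(N,M)=2^{N-1}\left(\frac{M+2}{2}\right)^{\frac{(4M+1)(N-2)}{2M}}\prod_{j=2}^N\binom{M+j-2}{j-2}^{\frac1{2M}}.$$ Here, for a vector $\boldsymbol x=(x_1,\dots,x_n)$ over a number field $L$ of degree $d$ with local degrees $d_v$, $$H(\boldsymbol x)=\prod_{v\nmid\infty}\max_{1\le i\le n}\|x_i\|_v^{d_v/d}\;\prod_{v\mid\infty}\Big(\sum_{i=1}^n\|x_i\|_v^2\Big)^{d_v/(2d)},$$ where $\|\cdot\|_v$ extends the usual archimedean or $p$-adic absolute value of $\mathbb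 Q$; this does not depend on the choice of the number field $L$ containing the coordinates of $\boldsymbol x$. $H(F)$ is the height of the vector of coefficients of $F$. -/

import Mathlib

namespace SmallZeros

noncomputable section

/-- The absolute height on `K^ι` for a number field `K` of degree `d`: the Euclidean norm at the
infinite places, the maximum norm at the finite places. Here `v.mult` is the local degree of an
infinite place, and Mathlib's `FinitePlace` absolute values carry the local degree already, that is
they are `‖·‖_v ^ d_v` for the extension `‖·‖_v` of the usual `p`-adic absolute value. -/
def height (K : Type*) [Field K] [NumberField K] {ι : Type*} [Fintype ι] (x : ι → K) : ℝ :=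
  ((∏ v : NumberField.InfinitePlace K, √(∑ i, v (x i) ^ 2) ^ v.mult) *
    ∏ᶠ v : NumberField.FinitePlace K, ⨆ i, v (x i)) ^ (1 / (Module.finrank ℚ K : ℝ))

/-- The height of a polynomial over `K` is the height of its vector of coefficients. -/
def polyHeight {K : Type*} [Field K] [NumberField K] {σ : Type*} (F : MvPolynomial σ K) : ℝ :=
  height K (fun m : F.support => F.coeff m)

/-- The field `ℚ(z_i : i ∈ ι)` generated by the coordinates of a point. -/
abbrev coordField {Ω : Type*} [Field Ω] [CharZero Ω] {ι : Type*} (z : ι → Ω) :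
    IntermediateField ℚ Ω :=
  IntermediateField.adjoin ℚ (Set.range z)

theorem numberField_coordField {Ω : Type*} [Field Ω] [CharZero Ω] [Algebra.IsAlgebraic ℚ Ω]
    {ι : Type*} [Finite ι] (z : ι → Ω) :
    NumberField (coordField z) where
  to_charZero := inferInstance
  to_finiteDimensional :=
    IntermediateField.finiteDimensional_adjoin fun x _ => Algebra.IsIntegral.isIntegral x

/-- The absolute height of a point with algebraic coordinates, evaluated over the field generated by the coordinates. -/
def absHeight {Ω : Type*} [Field Ω] [CharZero Ω] [Algebra.IsAlgebraic ℚ Ω]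
    {ι : Type*} [Fintype ι] (z : ι → Ω) : ℝ :=
  haveI := numberField_coordField z
  height (coordField z) fun i => ⟨z i, IntermediateField.subset_adjoin ℚ _ ⟨i, rfl⟩⟩

/-- The degree `[K(z_i : i ∈ ι) : K]`. -/
def degOver (K : Type*) [Field K] {Ω : Type*} [Field Ω] [Algebra K Ω] {ι : Type*}
    (z : ι → Ω) : ℕ :=
  Module.finrank K (IntermediateField.adjoin K (Set.range z))

/-- The constant `C₂(N, M)`, for `N ≥ 2` and `M ≥ 1`. -/
def C₂ (N M : ℕ) : ℝ :=
  2 ^ (N - 1) * (((M : ℝ) + 2) / 2) ^ ((4 * (M : ℝ) + 1) * ((N : ℝ) - 2) / (2 * (M : ℝ))) *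
    ∏ j ∈ Finset.Icc 2 N, (((M + j - 2).choose (j - 2) : ℕ) : ℝ) ^ (1 / (2 * (M : ℝ)))

end

end SmallZeros

open NumberField Module

/-! Fix `i ≠ j`. Since `F(e_i) ≠ 0`, `F` does not vanish identically on `x_j = 0`, so it is nonzero
there at a point given by small nonzero integers `β` (`exists_eval_linePoly_ne_zero`). Put `g(T) =
F(β_1, …, β_j T, …, β_N)`. Its leading coefficient is `F(e_j) β_j ^ M ≠ 0` and `g(0) ≠ 0`, so its
`M` roots `α` are nonzero, have degree at most `M` over `K`, and give zeros of `F` without zero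
coordinates.

One of these zeros is small because the product of all their heights is. At each place, `|a|_v ∏
max(1, |α_t|_v)`, with `a` the leading coefficient, is at most the local norm of `g`: by Gauss's
lemma at finite places (`nonarch_leadingCoeff_mul_prod_le`), by Landau's bound on the Mahler measure
at infinite ones (`arch_leadingCoeff_mul_prod_le`). The product formula removes `a`
(`prod_relHeight_le`), and the smallest of the `M` heights is at most the `M`-th root of the bound
(`exists_isRoot_height_le`). This takes place over a splitting field, hence the need for
`height_ringHom`. -/

namespace SmallZeros

/-! ### Invariance of the height under field extension. -/

section FieldExtension

theorem prod_infinitePlace_pow_mult {K : Type*} [Field K] [NumberField K]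
    (f : InfinitePlace K → ℝ) :
    ∏ v, f v ^ v.mult = ∏ φ : K →+* ℂ, f (InfinitePlace.mk φ) := by
  classical
  rw [← Finset.prod_fiberwise Finset.univ InfinitePlace.mk fun φ => f (InfinitePlace.mk φ)]
  refine Finset.prod_congr rfl fun v _ => ?_
  rw [Finset.prod_congr rfl fun φ hφ => by rw [(Finset.mem_filter.mp hφ).2], Finset.prod_const,
    InfinitePlace.card_filter_mk_eq]

variable {K L : Type*} [Field K] [NumberField K] [Field L] [NumberField L] [Algebra K L]

theorem card_extensions_embedding (φ : K →+* ℂ)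
    [DecidablePred fun ψ : L →+* ℂ => ψ.comp (algebraMap K L) = φ] :
    (Finset.univ.filter fun ψ : L →+* ℂ => ψ.comp (algebraMap K L) = φ).card = finrank K L := by
  let _ := φ.toAlgebra
  rw [← AlgHom.card K L ℂ, ← Fintype.card_subtype]
  refine Fintype.card_congr ⟨fun ψ => ⟨ψ.1, fun r => congrArg (fun f => f r) ψ.2⟩,
    fun ψ => ⟨ψ.toRingHom, RingHom.ext fun r => ψ.commutes r⟩, fun _ => rfl, fun _ => rfl⟩

/-- Multiplicities turn products over places into products over complex embeddings, and each
embedding of `K` has `[L : K]` extensions to `L`. -/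
theorem prod_infinitePlace_comap (f : InfinitePlace K → ℝ) :
    ∏ w : InfinitePlace L, f (w.comap (algebraMap K L)) ^ w.mult =
      (∏ v, f v ^ v.mult) ^ finrank K L := by
  classical
  rw [prod_infinitePlace_pow_mult f,
    prod_infinitePlace_pow_mult fun w : InfinitePlace L => f (w.comap (algebraMap K L)),
    ← Finset.prod_fiberwise Finset.univ fun ψ : L →+* ℂ => ψ.comp (algebraMap K L),
    ← Finset.prod_pow]
  refine Finset.prod_congr rfl fun φ _ => ?_
  rw [Finset.prod_congr rfl fun ψ hψ => by
    rw [InfinitePlace.comap_mk, (Finset.mem_filter.mp hψ).2], Finset.prod_const,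
    card_extensions_embedding]

theorem hasFiniteMulSupport_iSup_finitePlace {ι : Type*} [Finite ι] {x : ι → K} (hx : x ≠ 0) :
    (fun v : FinitePlace K => ⨆ i, v (x i)).HasFiniteMulSupport := by
  have : Nonempty {j // x j ≠ 0} := nonempty_subtype.mpr <| Function.ne_iff.mp hx
  have key : (fun v : FinitePlace K => ⨆ i : {j // x j ≠ 0}, v (x i)).HasFiniteMulSupport :=
    .iSup fun i => FinitePlace.hasFiniteMulSupport i.2
  convert key with v
  exact Finite.iSup_eq_iSup_subtype (v := v.1) hx

theorem finprod_iSup_smul {ι : Type*} [Finite ι] {x : ι → K} (hx : x ≠ 0) {c : K} (hc : c ≠ 0) :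
    ∏ᶠ v : FinitePlace K, ⨆ i, v c * v (x i) =
      (∏ᶠ v : FinitePlace K, v c) * ∏ᶠ v : FinitePlace K, ⨆ i, v (x i) := by
  rw [← finprod_mul_distrib (FinitePlace.hasFiniteMulSupport hc)
    (hasFiniteMulSupport_iSup_finitePlace hx)]
  refine finprod_congr fun v => ?_
  rw [Real.mul_iSup_of_nonneg (apply_nonneg v c)]

/-- The product of local maxima is the inverse norm of the ideal generated by the coordinates, and
extending an ideal to `L` raises its norm to the power `[L : K]`. -/
theorem finprod_iSup_algebraMap_integral {ι : Type*} [Finite ι] {x : ι → 𝓞 K} (hx : x ≠ 0) :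
    ∏ᶠ w : FinitePlace L, ⨆ i, w (algebraMap K L (x i)) =
      (∏ᶠ v : FinitePlace K, ⨆ i, v (x i : K)) ^ finrank K L := by
  have h1 := absNorm_mul_finprod_finitePlace_eq_one hx
  have hy : (fun i => algebraMap (𝓞 K) (𝓞 L) (x i)) ≠ 0 := by
    contrapose! hx
    ext1 i
    exact FaithfulSMul.algebraMap_injective (𝓞 K) (𝓞 L) (by simpa using congrFun hx i)
  have h2 := absNorm_mul_finprod_finitePlace_eq_one hy
  have hm : Ideal.span (Set.range fun i => algebraMap (𝓞 K) (𝓞 L) (x i)) =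
      (Ideal.span (Set.range x)).map (algebraMap (𝓞 K) (𝓞 L)) := by
    rw [Ideal.map_span, ← Set.range_comp]; rfl
  rw [hm, Ideal.absNorm_algebraMap] at h2
  have hr : finrank (𝓞 K) (𝓞 L) = finrank K L :=
    (IsFractionRing.finrank_eq (𝓞 K) K (𝓞 L) L).symm
  rw [hr] at h2
  refine mul_left_cancel₀ (a := ((Ideal.span (Set.range x)).absNorm : ℝ) ^ finrank K L)
    (pow_ne_zero _ (left_ne_zero_of_mul_eq_one h1)) ?_
  rw [← mul_pow, h1, one_pow, ← h2, Nat.cast_pow]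
  rfl

theorem finprod_iSup_algebraMap {ι : Type*} [Finite ι] {x : ι → K} (hx : x ≠ 0) :
    ∏ᶠ w : FinitePlace L, ⨆ i, w (algebraMap K L (x i)) =
      (∏ᶠ v : FinitePlace K, ⨆ i, v (x i)) ^ finrank K L := by
  obtain ⟨⟨c, hc⟩, h⟩ := IsLocalization.exist_integer_multiples_of_finite (nonZeroDivisors (𝓞 K)) x
  choose y hy using h
  have hc0 : c ≠ 0 := nonZeroDivisors.ne_zero hc
  have hcK : (c : K) ≠ 0 := by simpa using hc0
  have hcL : algebraMap K L c ≠ 0 := by simpa using hc0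
  have hy' : ∀ i, (y i : K) = c * x i := fun i => by
    simpa [Algebra.smul_def] using hy i
  have hxL : (fun i => algebraMap K L (x i)) ≠ 0 := by
    contrapose! hx
    ext1 i
    exact (algebraMap K L).injective (by simpa using congrFun hx i)
  have hy0 : y ≠ 0 := by
    contrapose! hx
    ext1 i
    simpa [hx, hc0] using (hy' i).symm
  have h1 := finprod_iSup_algebraMap_integral (L := L) hy0
  -- The integral case for the single coordinate `c` supplies the factor by which the common
  -- denominator cancels.
  have h2 := finprod_iSup_algebraMap_integral (L := L) (x := fun _ : Unit => c)
    (fun h => hc0 (congrFun h ()))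
  simp only [hy', map_mul, ciSup_const] at h1 h2
  rw [finprod_iSup_smul hxL hcL, h2, finprod_iSup_smul hx hcK, mul_pow] at h1
  have hc1 : ∏ᶠ v : FinitePlace K, v (c : K) ≠ 0 := by
    rw [FinitePlace.prod_eq_inv_abs_norm hcK]
    simpa using hc0
  exact mul_left_cancel₀ (pow_ne_zero _ hc1) h1

theorem height_algebraMap {ι : Type*} [Fintype ι] {x : ι → K} (hx : x ≠ 0) :
    height L (fun i => algebraMap K L (x i)) = height K x := by
  have h1 := prod_infinitePlace_comap (L := L) fun v : InfinitePlace K => √(∑ i, v (x i) ^ 2)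
  simp only [InfinitePlace.comap_apply] at h1
  unfold height
  rw [h1, finprod_iSup_algebraMap hx, ← mul_pow, ← finrank_mul_finrank ℚ K L,
    ← Real.rpow_natCast, ← Real.rpow_mul]
  · congr 1
    have : (finrank K L : ℝ) ≠ 0 := by exact_mod_cast (finrank_pos (R := K) (M := L)).ne'
    push_cast
    field_simp
  · exact mul_nonneg (Finset.prod_nonneg fun v _ => by positivity)
      (finprod_nonneg fun v => Real.iSup_nonneg fun i => apply_nonneg v _)

theorem height_ringHom {K L : Type*} [Field K] [NumberField K] [Field L] [NumberField L]
    (f : K →+* L) {ι : Type*} [Fintype ι] {x : ι → K} (hx : x ≠ 0) :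
    height L (fun i => f (x i)) = height K x := by
  let _ := f.toAlgebra
  exact height_algebraMap hx

theorem polyHeight_map {K L : Type*} [Field K] [NumberField K] [Field L] [NumberField L]
    (f : K →+* L) {σ : Type*} {F : MvPolynomial σ K} (hF : F ≠ 0) :
    polyHeight (MvPolynomial.map f F) = polyHeight F := by
  have hs : (MvPolynomial.map f F).support = F.support :=
    MvPolynomial.support_map_of_injective _ f.injective
  unfold polyHeight
  rw [← height_ringHom f (x := fun m : F.support => F.coeff m)]
  · simp only [MvPolynomial.coeff_map]
    rw [hs]
  · obtain ⟨m, hm⟩ := MvPolynomial.support_nonempty.mpr hF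
    exact fun h => MvPolynomial.mem_support_iff.mp hm (congrFun h ⟨m, hm⟩)

end FieldExtension

/-! ### Restriction of a form to a line, and local bounds for its coefficients. -/

section Restriction

open Polynomial

variable {K : Type*} [Field K] {σ : Type*} [Fintype σ]

/-- The restriction of `F` to the affine line through the point with coordinates `β i`, `i ≠ j`, and
`0` at `j`, in the direction of the `j`-th basis vector, with parameter scaled by `β j`. -/
noncomputable def linePoly (F : MvPolynomial σ K) (β : σ → ℤ) (j : σ) : K[X] :=
  ∑ m ∈ F.support, monomial (m j) (F.coeff m * ∏ i, (β i : K) ^ m i)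

theorem coeff_linePoly (F : MvPolynomial σ K) (β : σ → ℤ) (j : σ) (k : ℕ) :
    (linePoly F β j).coeff k =
      ∑ m ∈ F.support with m j = k, F.coeff m * ∏ i, (β i : K) ^ m i := by
  simp only [linePoly, finsetSum_coeff, coeff_monomial, Finset.sum_filter]

theorem linePoly_map {L : Type*} [Field L] (f : K →+* L) (F : MvPolynomial σ K) (β : σ → ℤ)
    (j : σ) : linePoly (MvPolynomial.map f F) β j = (linePoly F β j).map f := by
  rw [linePoly, linePoly, MvPolynomial.support_map_of_injective _ f.injective, Polynomial.map_sum]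
  simp [MvPolynomial.coeff_map]

theorem aeval_linePoly [DecidableEq σ] {Ω : Type*} [Field Ω] [Algebra K Ω] (F : MvPolynomial σ K)
    (β : σ → ℤ) (j : σ) (α : Ω) :
    aeval α (linePoly F β j) =
      MvPolynomial.aeval (fun i => (β i : Ω) * if i = j then α else 1) F := by
  rw [linePoly, map_sum, MvPolynomial.aeval_def, MvPolynomial.eval₂_eq']
  refine Finset.sum_congr rfl fun m _ => ?_
  rw [aeval_monomial]
  simp only [mul_pow, Finset.prod_mul_distrib, ite_pow, one_pow, Finset.prod_ite_eq',
    Finset.mem_univ, if_true, map_mul, map_prod, map_pow, map_intCast, mul_assoc]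

theorem sum_exponents_of_mem_support {F : MvPolynomial σ K} {M : ℕ} (hF : F.IsHomogeneous M)
    {m : σ →₀ ℕ} (hm : m ∈ F.support) : ∑ i, m i = M := by
  rw [hF.degree_eq_sum_deg_support hm]
  exact (Finset.sum_subset (Finset.subset_univ _) (by simp)).symm

theorem apply_le_of_mem_support {F : MvPolynomial σ K} {M : ℕ} (hF : F.IsHomogeneous M)
    {m : σ →₀ ℕ} (hm : m ∈ F.support) (j : σ) : m j ≤ M := by
  rw [← sum_exponents_of_mem_support hF hm]
  exact Finset.single_le_sum (fun i _ => Nat.zero_le (m i)) (Finset.mem_univ j)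

theorem eq_single_of_apply_eq {F : MvPolynomial σ K} {M : ℕ} (hF : F.IsHomogeneous M)
    {m : σ →₀ ℕ} (hm : m ∈ F.support) {j : σ} (hj : m j = M) : m = Finsupp.single j M := by
  classical
  have h := sum_exponents_of_mem_support hF hm
  rw [← Finset.add_sum_erase _ _ (Finset.mem_univ j), hj] at h
  have h0 : ∑ i ∈ Finset.univ.erase j, m i = 0 := by omega
  ext i
  rcases eq_or_ne i j with rfl | hi
  · simp [hj]
  · rw [Finsupp.single_eq_of_ne hi]
    exact (Finset.sum_eq_zero_iff.mp h0) i (by simp [hi])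

theorem natDegree_linePoly_le {F : MvPolynomial σ K} {M : ℕ} (hF : F.IsHomogeneous M)
    (β : σ → ℤ) (j : σ) : (linePoly F β j).natDegree ≤ M := by
  refine natDegree_sum_le_of_forall_le _ _ fun m hm => (natDegree_monomial_le _).trans ?_
  exact apply_le_of_mem_support hF hm j

theorem coeff_linePoly_degree {F : MvPolynomial σ K} {M : ℕ} (hF : F.IsHomogeneous M)
    (β : σ → ℤ) (j : σ) :
    (linePoly F β j).coeff M = F.coeff (Finsupp.single j M) * (β j : K) ^ M := by
  classical
  rw [coeff_linePoly, Finset.sum_subset (s₂ := {Finsupp.single j M})]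
  · rw [Finset.sum_singleton, Finset.prod_eq_single j]
    · simp
    · intro i _ hi
      simp [Finsupp.single_eq_of_ne hi]
    · simp
  · intro m hm
    obtain ⟨hm, hj⟩ := Finset.mem_filter.mp hm
    exact Finset.mem_singleton.mpr (eq_single_of_apply_eq hF hm hj)
  · intro m hm hm'
    rw [Finset.mem_singleton] at hm
    subst hm
    have : F.coeff (Finsupp.single j M) = 0 := by simpa using hm'
    simp [this]

theorem eval_single_one [DecidableEq σ] {F : MvPolynomial σ K} {M : ℕ} (hF : F.IsHomogeneous M)
    (j : σ) : MvPolynomial.eval (Pi.single j (1 : K)) F = F.coeff (Finsupp.single j M) := by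
  rw [MvPolynomial.eval_eq', Finset.sum_eq_single (Finsupp.single j M)]
  · rw [Finset.prod_eq_one, mul_one]
    intro i _
    rcases eq_or_ne i j with rfl | hi
    · simp
    · simp [Finsupp.single_eq_of_ne hi]
  · intro m hm hne
    obtain ⟨i, hij, hi⟩ : ∃ i, i ≠ j ∧ m i ≠ 0 := by
      by_contra! h
      refine hne (eq_single_of_apply_eq hF hm ?_)
      rw [← sum_exponents_of_mem_support hF hm]
      exact (Finset.sum_eq_single j (fun i _ hi => h i hi) (by simp)).symm
    rw [Finset.prod_eq_zero (Finset.mem_univ i), mul_zero]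
    simp [hij, hi]
  · intro h
    rw [MvPolynomial.notMem_support_iff.mp h, zero_mul]

theorem nonarch_coeff_linePoly_le {v : AbsoluteValue K ℝ} (hv : IsNonarchimedean v)
    (F : MvPolynomial σ K) (β : σ → ℤ) (j : σ) (k : ℕ) :
    v ((linePoly F β j).coeff k) ≤ ⨆ m : F.support, v (F.coeff m) := by
  have h0 : 0 ≤ ⨆ m : F.support, v (F.coeff m) := Real.iSup_nonneg fun _ => v.nonneg _
  rw [coeff_linePoly]
  refine hv.apply_sum_le.trans (Real.iSup_le (fun m => ?_) h0)
  have hm := (Finset.mem_filter.mp m.2).1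
  have h1 : v (∏ i, (β i : K) ^ m.1 i) ≤ 1 := by
    rw [map_prod]
    refine Finset.prod_le_one (fun i _ => v.nonneg _) fun i _ => ?_
    rw [map_pow]
    exact pow_le_one₀ (v.nonneg _) hv.apply_intCast_le_one
  rw [map_mul]
  exact (mul_le_of_le_one_right (v.nonneg _) h1).trans
    (Finite.le_ciSup (fun m : F.support => v (F.coeff m)) ⟨m.1, hm⟩)

/-- Erasing the exponent at `j` injects into the monomials of degree `M - k` in one variable fewer,
which are most numerous for `k = 0`. -/
theorem card_exponents_le [DecidableEq σ] {F : MvPolynomial σ K} {M : ℕ} (hF : F.IsHomogeneous M)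
    (hσ : 2 ≤ Fintype.card σ) (j : σ) (k : ℕ) :
    (F.support.filter fun m => m j = k).card ≤
      (M + Fintype.card σ - 2).choose (Fintype.card σ - 2) := by
  have hle : (F.support.filter fun m => m j = k).card ≤
      ((Finset.univ.erase j).finsuppAntidiag (M - k)).card := by
    refine Finset.card_le_card_of_injOn (fun m => m.erase j) ?_ ?_
    · intro m hm
      obtain ⟨hmF, hk⟩ := Finset.mem_filter.mp (Finset.mem_coe.mp hm)
      have h := sum_exponents_of_mem_support hF hmF
      rw [← Finset.add_sum_erase _ _ (Finset.mem_univ j)] at h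
      rw [Finset.mem_coe, Finset.mem_finsuppAntidiag]
      refine ⟨?_, by simpa using Finset.erase_subset_erase j (Finset.subset_univ m.support)⟩
      rw [Finset.sum_congr rfl fun i hi => Finsupp.erase_ne (Finset.ne_of_mem_erase hi)]
      omega
    · intro m hm m' hm' h
      rw [← Finsupp.single_add_erase j m, ← Finsupp.single_add_erase j m',
        (Finset.mem_filter.mp hm).2, (Finset.mem_filter.mp hm').2]
      exact congrArg _ h
  refine hle.trans ?_
  rw [Finset.card_finsuppAntidiag_nat_eq_choose, Finset.card_erase_of_mem (Finset.mem_univ j),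
    Finset.card_univ]
  obtain ⟨n, hn⟩ := Nat.exists_eq_add_of_le hσ
  rw [hn, show 2 + n - 1 + (M - k) - 1 = n + (M - k) by omega, show M + (2 + n) - 2 = M + n by omega,
    show 2 + n - 2 = n by omega, ← Nat.choose_symm_add]
  exact Nat.choose_le_choose _ (by omega)

/-- Cauchy–Schwarz is applied to each coefficient separately. Each monomial of `F` feeds only one
coefficient, so the binomial factor enters once. -/
theorem sum_sq_coeff_linePoly_le {v : AbsoluteValue K ℝ} (hv : ∀ n : ℤ, v n = |(n : ℝ)|)
    {F : MvPolynomial σ K} {M : ℕ} (hF : F.IsHomogeneous M) (hσ : 2 ≤ Fintype.card σ)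
    {β : σ → ℤ} {A : ℝ} (hβ : ∀ i, |(β i : ℝ)| ≤ A) (j : σ) (s : Finset ℕ) :
    ∑ k ∈ s, v ((linePoly F β j).coeff k) ^ 2 ≤
      (A ^ M) ^ 2 * (M + Fintype.card σ - 2).choose (Fintype.card σ - 2) *
        ∑ m : F.support, v (F.coeff m) ^ 2 := by
  classical
  set c := (M + Fintype.card σ - 2).choose (Fintype.card σ - 2)
  have hprod : ∀ m ∈ F.support, v (∏ i, (β i : K) ^ m i) ≤ A ^ M := by
    intro m hm
    rw [map_prod, ← sum_exponents_of_mem_support hF hm, ← Finset.prod_pow_eq_pow_sum]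
    refine Finset.prod_le_prod (fun i _ => v.nonneg _) fun i _ => ?_
    rw [map_pow, hv]
    exact pow_le_pow_left₀ (abs_nonneg _) (hβ i) _
  have hk : ∀ k, v ((linePoly F β j).coeff k) ^ 2 ≤
      (A ^ M) ^ 2 * c * ∑ m ∈ F.support with m j = k, v (F.coeff m) ^ 2 := by
    intro k
    rw [coeff_linePoly]
    calc v (∑ m ∈ F.support with m j = k, F.coeff m * ∏ i, (β i : K) ^ m i) ^ 2
        ≤ (∑ m ∈ F.support with m j = k, A ^ M * v (F.coeff m)) ^ 2 := by
          gcongr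
          refine (v.sum_le _ _).trans (Finset.sum_le_sum fun m hm => ?_)
          rw [map_mul, mul_comm]
          exact mul_le_mul_of_nonneg_right (hprod m (Finset.mem_filter.mp hm).1) (v.nonneg _)
      _ = (A ^ M) ^ 2 * (∑ m ∈ F.support with m j = k, v (F.coeff m)) ^ 2 := by
          rw [← Finset.mul_sum, mul_pow]
      _ ≤ (A ^ M) ^ 2 * ((F.support.filter fun m => m j = k).card *
            ∑ m ∈ F.support with m j = k, v (F.coeff m) ^ 2) := by
          gcongr
          exact sq_sum_le_card_mul_sum_sq
      _ ≤ _ := by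
          rw [mul_assoc]
          gcongr
          exact card_exponents_le hF hσ j k
  calc ∑ k ∈ s, v ((linePoly F β j).coeff k) ^ 2
      ≤ ∑ k ∈ s, (A ^ M) ^ 2 * c * ∑ m ∈ F.support with m j = k, v (F.coeff m) ^ 2 :=
        Finset.sum_le_sum fun k _ => hk k
    _ = (A ^ M) ^ 2 * c * ∑ k ∈ s, ∑ m ∈ F.support with m j = k, v (F.coeff m) ^ 2 := by
        rw [Finset.mul_sum]
    _ ≤ _ := by
        rw [Finset.sum_coe_sort F.support fun m => v (F.coeff m) ^ 2]
        gcongr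
        exact Finset.sum_fiberwise_le_sum_of_sum_fiber_nonneg fun _ _ =>
          Finset.sum_nonneg fun _ _ => by positivity

end Restriction

/-! ### Local bounds for roots in terms of coefficients. -/

section Roots

open Polynomial

/-- Gauss's lemma: the Gauss norm at radius 1 is multiplicative, and that of `X - r` is at least
`max 1 (v r)`. -/
theorem nonarch_leadingCoeff_mul_prod_le {K : Type*} [Field K] {v : AbsoluteValue K ℝ}
    (hv : IsNonarchimedean v) {ι : Type*} (s : Finset ι) (a : K) (r : ι → K) {B : ℝ}
    (hB : ∀ k, v ((C a * ∏ i ∈ s, (X - C (r i))).coeff k) ≤ B) :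
    v a * ∏ i ∈ s, max 1 (v (r i)) ≤ B := by
  have h1 : v a * ∏ i ∈ s, max 1 (v (r i)) ≤ (C a * ∏ i ∈ s, (X - C (r i))).gaussNorm v 1 := by
    rw [gaussNorm_mul hv one_pos, gaussNorm_C]
    refine mul_le_mul_of_nonneg_left ?_ (v.nonneg a)
    clear hB
    classical
    induction s using Finset.induction_on with
    | empty => simpa using (gaussNorm_C v 1 (1 : K)).ge
    | insert i s hi ih =>
      rw [Finset.prod_insert hi, Finset.prod_insert hi, gaussNorm_mul hv one_pos]
      refine mul_le_mul (max_le ?_ ?_) ih (Finset.prod_nonneg fun i _ => by positivity)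
        (gaussNorm_nonneg v _ zero_le_one)
      · have h : v ((X - C (r i)).coeff 1) = 1 := by simp [coeff_C_succ]
        exact h.symm.le.trans (by
          have h := le_gaussNorm v (X - C (r i)) zero_le_one 1
          rwa [one_pow, mul_one] at h)
      · have h : v ((X - C (r i)).coeff 0) = v (r i) := by simp [v.map_neg]
        exact h.symm.le.trans (by
          have h := le_gaussNorm v (X - C (r i)) zero_le_one 0
          rwa [one_pow, mul_one] at h)
  obtain ⟨k, hk⟩ := exists_eq_gaussNorm v 1 (C a * ∏ i ∈ s, (X - C (r i)))
  rw [hk, one_pow, mul_one] at h1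
  exact h1.trans (hB k)

theorem arch_leadingCoeff_mul_prod_le {K : Type*} [Field K] [NumberField K] (v : InfinitePlace K)
    {ι : Type*} (s : Finset ι) (a : K) (r : ι → K) {B : ℝ}
    (hB : ∀ t : Finset ℕ, ∑ k ∈ t, v ((C a * ∏ i ∈ s, (X - C (r i))).coeff k) ^ 2 ≤ B) :
    v a * ∏ i ∈ s, max 1 (v (r i)) ≤ √B := by
  set φ := v.embedding
  have hφ : ∀ x, ‖φ x‖ = v x := fun x => InfinitePlace.norm_embedding_eq v x
  have hmap : (C a * ∏ i ∈ s, (X - C (r i))).map φ =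
      C (φ a) * ∏ i ∈ s, (X - C (φ (r i))) := by
    simp [Polynomial.map_prod]
  have h1 := mahlerMeasure_le_sqrt_sum_sq_norm_coeff ((C a * ∏ i ∈ s, (X - C (r i))).map φ)
  have h2 : mahlerMeasure ((C a * ∏ i ∈ s, (X - C (r i))).map φ) =
      v a * ∏ i ∈ s, max 1 (v (r i)) := by
    have hprod : mahlerMeasure (∏ i ∈ s, (X - C (φ (r i)))) = ∏ i ∈ s, max 1 (v (r i)) := by
      clear hB hmap h1
      classical
      induction s using Finset.induction_on with
      | empty => simp
      | insert i s hi ih =>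
        rw [Finset.prod_insert hi, Finset.prod_insert hi, mahlerMeasure_mul, ih,
          mahlerMeasure_X_sub_C, hφ]
    rw [hmap, mahlerMeasure_mul, mahlerMeasure_const, hprod, hφ]
  rw [h2] at h1
  refine h1.trans (Real.sqrt_le_sqrt ?_)
  simpa only [coeff_map, hφ] using hB _

theorem exists_eq_map_univ_val {α : Type*} {s : Multiset α} {n : ℕ} (hs : s.card = n) :
    ∃ r : Fin n → α, s = Finset.univ.val.map r := by
  subst hs
  induction s using Quotient.inductionOn with
  | h l => exact ⟨l.get, ((Fin.univ_val_map l.get).trans (congrArg _ (List.ofFn_get l))).symm⟩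

theorem rpow_le_of_pow_le {R S c : ℝ} {M d : ℕ} (hM : M ≠ 0) (hd : d ≠ 0) (hR : 0 ≤ R)
    (hS : 0 ≤ S) (hc : 0 ≤ c) (h : R ^ M ≤ c ^ d * S) :
    R ^ (1 / (d : ℝ)) ≤ c ^ (1 / (M : ℝ)) * (S ^ (1 / (d : ℝ))) ^ (1 / (M : ℝ)) := by
  have h1 : R ≤ (c ^ d * S) ^ (1 / (M : ℝ)) := by
    rw [one_div, Real.le_rpow_inv_iff_of_pos hR (by positivity) (by positivity),
      Real.rpow_natCast]
    exact h
  calc R ^ (1 / (d : ℝ)) ≤ ((c ^ d * S) ^ (1 / (M : ℝ))) ^ (1 / (d : ℝ)) := by gcongr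
    _ = ((c ^ d * S) ^ (1 / (d : ℝ))) ^ (1 / (M : ℝ)) := by
      rw [← Real.rpow_mul (by positivity), ← Real.rpow_mul (by positivity), mul_comm (1 / (M : ℝ))]
    _ = _ := by
      rw [Real.mul_rpow (by positivity) hS, one_div (d : ℝ), Real.pow_rpow_inv_natCast hc hd,
        Real.mul_rpow hc (by positivity)]

theorem exists_pow_le_of_prod_le {ι : Type*} [Fintype ι] [Nonempty ι] {f : ι → ℝ} {B : ℝ}
    (hf : ∀ i, 0 ≤ f i) (h : ∏ i, f i ≤ B) : ∃ i, f i ^ Fintype.card ι ≤ B := by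
  obtain ⟨i, hi⟩ := Finite.exists_min f
  refine ⟨i, le_trans ?_ h⟩
  rw [← Finset.card_univ, ← Finset.prod_const]
  exact Finset.prod_le_prod (fun _ _ => hf i) fun j _ => hi j

end Roots

/-! ### From local inequalities to heights. -/

section Comparison

variable {K : Type*} [Field K] [NumberField K]

/-- The height to the power of the degree of `K`. -/
noncomputable def relHeight (K : Type*) [Field K] [NumberField K] {ι : Type*} [Fintype ι]
    (x : ι → K) : ℝ :=
  (∏ v : InfinitePlace K, √(∑ i, v (x i) ^ 2) ^ v.mult) * ∏ᶠ v : FinitePlace K, ⨆ i, v (x i)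

theorem relHeight_nonneg {ι : Type*} [Fintype ι] (x : ι → K) : 0 ≤ relHeight K x :=
  mul_nonneg (Finset.prod_nonneg fun v _ => by positivity)
    (finprod_nonneg fun v => Real.iSup_nonneg fun i => apply_nonneg v _)

/-- By the product formula, inserting `v a` at every place changes nothing. The constant `c` enters
only at infinite places, whose local degrees sum to `[K : ℚ]`. -/
theorem prod_relHeight_le {ι τ κ : Type*} [Fintype ι] [Fintype τ] [Fintype κ]
    {a : K} (ha : a ≠ 0) {z : τ → ι → K} (hz : ∀ t, z t ≠ 0) {y : κ → K} (hy : y ≠ 0) {c : ℝ}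
    (hinf : ∀ v : InfinitePlace K,
      v a * ∏ t, √(∑ i, v (z t i) ^ 2) ≤ c * √(∑ k, v (y k) ^ 2))
    (hfin : ∀ v : FinitePlace K, v a * ∏ t, ⨆ i, v (z t i) ≤ ⨆ k, v (y k)) :
    ∏ t, relHeight K (z t) ≤ c ^ finrank ℚ K * relHeight K y := by
  have hs : (fun v : FinitePlace K => ∏ t, ⨆ i, v (z t i)).HasFiniteMulSupport :=
    .prod (fun t => hasFiniteMulSupport_iSup_finitePlace (hz t)) Finset.univ
  have hsa := FinitePlace.hasFiniteMulSupport ha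
  have hn : ∀ v : FinitePlace K, 0 ≤ v a * ∏ t, ⨆ i, v (z t i) := fun v =>
    mul_nonneg (apply_nonneg v a)
      (Finset.prod_nonneg fun t _ => Real.iSup_nonneg fun i => apply_nonneg v _)
  calc ∏ t, relHeight K (z t)
      = ((∏ v : InfinitePlace K, v a ^ v.mult) * ∏ᶠ v : FinitePlace K, v a) *
          ∏ t, relHeight K (z t) := by rw [prod_abs_eq_one ha, one_mul]
    _ = (∏ v : InfinitePlace K, (v a * ∏ t, √(∑ i, v (z t i) ^ 2)) ^ v.mult) *
          ∏ᶠ v : FinitePlace K, v a * ∏ t, ⨆ i, v (z t i) := by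
        rw [finprod_mul_distrib hsa hs,
          finprod_prod_comm _ _ fun t _ => hasFiniteMulSupport_iSup_finitePlace (hz t)]
        simp only [relHeight, mul_pow, Finset.prod_mul_distrib, ← Finset.prod_pow]
        rw [Finset.prod_comm]
        ring
    _ ≤ (∏ v : InfinitePlace K, (c * √(∑ k, v (y k) ^ 2)) ^ v.mult) *
          ∏ᶠ v : FinitePlace K, ⨆ k, v (y k) := by
        refine mul_le_mul (Finset.prod_le_prod (fun v _ => by positivity) fun v _ =>
          pow_le_pow_left₀ (by positivity) (hinf v) _)
          (finprod_le_finprod (.mul hsa hs) hn (hasFiniteMulSupport_iSup_finitePlace hy) hfin)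
          (finprod_nonneg hn)
          (Finset.prod_nonneg fun v _ => pow_nonneg (le_trans (by positivity) (hinf v)) _)
    _ = c ^ finrank ℚ K * relHeight K y := by
        simp only [mul_pow, Finset.prod_mul_distrib, Finset.prod_pow_eq_pow_sum,
          InfinitePlace.sum_mult_eq, relHeight]
        ring

end Comparison

/-! ### A root of small height when the restricted polynomial splits. -/

section SplitLine

open Polynomial

variable {K : Type*} [Field K] [NumberField K] {σ : Type*} [Fintype σ] [DecidableEq σ]

omit [NumberField K] in
theorem sqrt_sum_sq_le_mul_max (v : InfinitePlace K) {β : σ → ℤ} {A : ℝ}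
    (hβ : ∀ i, |(β i : ℝ)| ≤ A) (j : σ) (α : K) :
    √(∑ i, v ((β i : K) * if i = j then α else 1) ^ 2) ≤
      √(Fintype.card σ) * A * max 1 (v α) := by
  have hA : 0 ≤ A := (abs_nonneg _).trans (hβ j)
  rw [mul_assoc, ← Real.sqrt_sq (show 0 ≤ A * max 1 (v α) by positivity),
    ← Real.sqrt_mul (Nat.cast_nonneg _)]
  refine Real.sqrt_le_sqrt ?_
  rw [← nsmul_eq_mul, ← Finset.card_univ]
  refine Finset.sum_le_card_nsmul _ _ _ fun i _ => ?_
  rw [map_mul, InfinitePlace.map_intCast]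
  gcongr
  · exact hβ i
  · split_ifs <;> simp

omit [Fintype σ] in
theorem iSup_finitePlace_le_max [Nonempty σ] (v : FinitePlace K) (β : σ → ℤ) (j : σ) (α : K) :
    ⨆ i, v ((β i : K) * if i = j then α else 1) ≤ max 1 (v α) := by
  refine ciSup_le fun i => ?_
  rw [map_mul]
  have hna : IsNonarchimedean v.1 := v.add_le
  refine (mul_le_of_le_one_left (apply_nonneg v _) (hna.apply_intCast_le_one (n := β i))).trans ?_
  split_ifs <;> simp

theorem exists_isRoot_height_le {M : ℕ} (hM : 1 ≤ M) {F : MvPolynomial σ K}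
    (hF : F.IsHomogeneous M) (hσ : 2 ≤ Fintype.card σ) {β : σ → ℤ} (hβ0 : ∀ i, β i ≠ 0)
    {A : ℝ} (hβ : ∀ i, |(β i : ℝ)| ≤ A) {j : σ} (hFj : F.coeff (Finsupp.single j M) ≠ 0)
    (hsplit : (linePoly F β j).Splits) :
    ∃ α, (linePoly F β j).IsRoot α ∧
      height K (fun i => (β i : K) * if i = j then α else 1) ≤
        √(Fintype.card σ) * A ^ 2 *
          ((M + Fintype.card σ - 2).choose (Fintype.card σ - 2) : ℝ) ^ (1 / (2 * (M : ℝ))) *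
          polyHeight F ^ (1 / (M : ℝ)) := by
  set g := linePoly F β j with hg
  set b : ℝ := ((M + Fintype.card σ - 2).choose (Fintype.card σ - 2) : ℝ) with hb
  have hA : 0 ≤ A := (abs_nonneg _).trans (hβ j)
  have hgM : g.coeff M ≠ 0 := by
    rw [hg, coeff_linePoly_degree hF]
    exact mul_ne_zero hFj (pow_ne_zero _ (by exact_mod_cast hβ0 j))
  have hg0 : g ≠ 0 := fun h => hgM (by simp [h])
  have hdeg : g.natDegree = M :=
    le_antisymm (natDegree_linePoly_le hF β j) (le_natDegree_of_ne_zero hgM)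
  have hcard : g.roots.card = M := by rw [← hsplit.natDegree_eq_card_roots, hdeg]
  obtain ⟨r, hr⟩ : ∃ r : Fin M → K, g.roots = Finset.univ.val.map r :=
    exists_eq_map_univ_val hcard
  have ha : g.leadingCoeff ≠ 0 := leadingCoeff_ne_zero.mpr hg0
  have hprod : C g.leadingCoeff * ∏ t, (X - C (r t)) = g := by
    conv_rhs => rw [hsplit.eq_prod_roots, hr, Multiset.map_map]
    rfl
  have : Nonempty (Fin M) := ⟨⟨0, hM⟩⟩
  have : Nonempty σ := ⟨j⟩
  set z : Fin M → σ → K := fun t i => (β i : K) * if i = j then r t else 1 with hzdef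
  have hz : ∀ t, z t ≠ 0 := by
    intro t h
    obtain ⟨i, hi⟩ := Fintype.exists_ne_of_one_lt_card (show 1 < Fintype.card σ by omega) j
    have := congrFun h i
    simp [hzdef, hi, hβ0 i] at this
  have hy : (fun m : F.support => F.coeff m) ≠ 0 := fun h =>
    hFj (congrFun h ⟨Finsupp.single j M, MvPolynomial.mem_support_iff.mpr hFj⟩)
  -- The first factor compares each of the `M` points with `max 1 |r t|`; the second compares the
  -- coefficients of `g` with those of `F`.
  have key := prod_relHeight_le (c := (√(Fintype.card σ) * A) ^ M * (A ^ M * √b)) ha hz hy ?_ ?_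
  · obtain ⟨t, ht⟩ := exists_pow_le_of_prod_le (fun t => relHeight_nonneg (z t)) key
    refine ⟨r t, ?_, ?_⟩
    · rw [← mem_roots hg0, hr]
      exact Multiset.mem_map_of_mem r (Finset.mem_univ_val t)
    · rw [Fintype.card_fin] at ht
      have h1 := rpow_le_of_pow_le (by omega) finrank_pos.ne' (relHeight_nonneg _)
        (relHeight_nonneg _) (by positivity) ht
      have h2 : ((√(Fintype.card σ) * A) ^ M * (A ^ M * √b)) ^ (1 / (M : ℝ)) =
          √(Fintype.card σ) * A ^ 2 * b ^ (1 / (2 * (M : ℝ))) := by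
        have hb0 : 0 ≤ b := Nat.cast_nonneg _
        rw [← mul_assoc, ← mul_pow, Real.mul_rpow (by positivity) (by positivity), one_div (M : ℝ),
          Real.pow_rpow_inv_natCast (by positivity) (by omega), Real.sqrt_eq_rpow b,
          ← Real.rpow_mul hb0]
        congr 1
        · ring
        · congr 1
          ring
      rw [h2] at h1
      exact h1
  · intro v
    have h1 := arch_leadingCoeff_mul_prod_le v Finset.univ g.leadingCoeff r
      (B := (A ^ M) ^ 2 * b * ∑ m : F.support, v (F.coeff m) ^ 2) (by
        rw [hprod]
        exact sum_sq_coeff_linePoly_le (v := v.1)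
          (fun n => InfinitePlace.map_intCast v n) hF hσ hβ j)
    rw [Real.sqrt_mul (by positivity), Real.sqrt_mul (by positivity),
      Real.sqrt_sq (by positivity)] at h1
    calc v g.leadingCoeff * ∏ t, √(∑ i, v (z t i) ^ 2)
        ≤ v g.leadingCoeff * ∏ t, (√(Fintype.card σ) * A * max 1 (v (r t))) := by
          gcongr with t
          exact sqrt_sum_sq_le_mul_max v hβ j (r t)
      _ = (√(Fintype.card σ) * A) ^ M * (v g.leadingCoeff * ∏ t, max 1 (v (r t))) := by
          rw [Finset.prod_mul_distrib, Finset.prod_const, Finset.card_univ, Fintype.card_fin]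
          ring
      _ ≤ (√(Fintype.card σ) * A) ^ M *
            (A ^ M * √b * √(∑ m : F.support, v (F.coeff m) ^ 2)) := by gcongr
      _ = _ := by ring
  · intro v
    have hna : IsNonarchimedean v.1 := v.add_le
    refine le_trans ?_ (nonarch_leadingCoeff_mul_prod_le hna Finset.univ g.leadingCoeff r (by
      rw [hprod]
      exact nonarch_coeff_linePoly_le hna F β j))
    refine mul_le_mul_of_nonneg_left (Finset.prod_le_prod
      (fun t _ => Real.iSup_nonneg fun i => apply_nonneg v _) fun t _ => ?_) (apply_nonneg v _)
    exact iSup_finitePlace_le_max v β j (r t)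

end SplitLine

/-! ### Choice of the integer coefficients `β`. -/

section Coefficients

variable {K : Type*} [Field K] [CharZero K]

theorem exists_eval_ne_zero_of_ne_zero {σ : Type*} [Finite σ] {M : ℕ} {p : MvPolynomial σ K}
    (hp : p.IsHomogeneous M) (hp0 : p ≠ 0) :
    ∃ β : σ → ℤ, (∀ i, β i ≠ 0) ∧ (∀ i, |(β i : ℝ)| ≤ ((M : ℝ) + 2) / 2) ∧
      MvPolynomial.eval (fun i => (β i : K)) p ≠ 0 := by
  classical
  -- The box of nonzero integers in `[-B, B]` has `2 * B > M` elements, more than the degree in any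
  -- variable, so a form vanishing on it would be zero.
  set B : ℤ := ((M / 2 + 1 : ℕ) : ℤ) with hB
  by_contra! h
  refine hp0 (MvPolynomial.eq_zero_of_eval_zero_at_prod_finset p
    (fun _ => ((Finset.Icc (-B) B).erase 0).image (Int.cast : ℤ → K)) (fun i => ?_) fun x hx => ?_)
  · rw [Finset.card_image_of_injective _ Int.cast_injective,
      Finset.card_erase_of_mem (by simp [hB]; omega), Int.card_Icc]
    have := (MvPolynomial.degreeOf_le_totalDegree p i).trans hp.totalDegree_le
    omega
  · choose β hβ hβx using fun i => Finset.mem_image.mp (hx i)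
    obtain rfl : (fun i => (β i : K)) = x := funext hβx
    refine h β (fun i => (Finset.mem_erase.mp (hβ i)).1) fun i => ?_
    have h1 := Finset.mem_Icc.mp (Finset.mem_erase.mp (hβ i)).2
    have h2 : |2 * β i| ≤ M + 2 := by
      rw [abs_le]
      omega
    have h3 : |2 * (β i : ℝ)| ≤ M + 2 := by exact_mod_cast h2
    rw [abs_mul, abs_two] at h3
    linarith

theorem exists_eval_linePoly_ne_zero {N M : ℕ} (hN : 2 ≤ N) {F : MvPolynomial (Fin N) K}
    (hF : F.IsHomogeneous M) {i j : Fin N} (hij : i ≠ j)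
    (hne : MvPolynomial.eval (Pi.single i (1 : K)) F ≠ 0) :
    ∃ β : Fin N → ℤ, (∀ i, β i ≠ 0) ∧ (∀ i, |(β i : ℝ)| ≤ (((M : ℝ) + 2) / 2) ^ (N - 2)) ∧
      (linePoly F β j).eval 0 ≠ 0 := by
  have heval : ∀ β : Fin N → ℤ, (linePoly F β j).eval 0 =
      MvPolynomial.eval (fun i => (β i : K) * if i = j then 0 else 1) F := fun β => by
    simpa [Polynomial.coe_aeval_eq_eval, MvPolynomial.aeval_eq_eval] using
      aeval_linePoly F β j (0 : K)
  rcases hN.eq_or_lt with rfl | hN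
  -- For `N = 2` the bound on `β` is a zeroth power, which forces entries `±1`. All ones will do, as
  -- the point with `x_j = 0` is then `e_i`.
  · refine ⟨1, by simp, by simp, ?_⟩
    rw [heval]
    convert hne using 2
    congr 1
    ext k
    rcases eq_or_ne k j with rfl | hk
    · simp [hij.symm]
    · obtain rfl : k = i := by omega
      simp [hk]
  · set p : MvPolynomial (Fin N) K :=
      MvPolynomial.aeval (fun i => if i = j then 0 else MvPolynomial.X i) F with hp
    have hpe : ∀ x : Fin N → K, MvPolynomial.eval x p =
        MvPolynomial.eval (fun i => x i * if i = j then 0 else 1) F := by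
      intro x
      rw [hp, MvPolynomial.aeval_def, MvPolynomial.eval_eval₂, MvPolynomial.eval,
        MvPolynomial.coe_eval₂Hom]
      congr 1
      · ext; simp
      · ext k
        split_ifs <;> simp
    have hph : p.IsHomogeneous M := by
      have := hF.aeval (n := 1) (fun i => if i = j then 0 else MvPolynomial.X (R := K) i)
        (fun i => by
          split_ifs
          · exact MvPolynomial.isHomogeneous_zero _ _ _
          · exact MvPolynomial.isHomogeneous_X _ _)
      rwa [one_mul] at this
    have hp0 : p ≠ 0 := by
      intro h
      have h1 := hpe (Pi.single i 1)
      rw [h, map_zero] at h1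
      refine hne (h1 ▸ ?_)
      congr 2
      ext k
      rcases eq_or_ne k j with rfl | hk
      · simp [hij.symm]
      · simp [hk]
    obtain ⟨β, hβ0, hβ, hβp⟩ := exists_eval_ne_zero_of_ne_zero hph hp0
    refine ⟨β, hβ0, fun i => (hβ i).trans (le_self_pow₀ ?_ (by omega)), ?_⟩
    · have : (0 : ℝ) ≤ M := Nat.cast_nonneg M
      linarith
    · rwa [heval, ← hpe fun i => (β i : K)]

end Coefficients

/-! ### Comparison with the stated constant, and conclusion. -/

theorem line_bound_le_C₂ {N M : ℕ} (hN : 2 ≤ N) (hM : 1 ≤ M) :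
    √N * ((((M : ℝ) + 2) / 2) ^ (N - 2)) ^ 2 *
      ((M + N - 2).choose (N - 2) : ℝ) ^ (1 / (2 * (M : ℝ))) ≤ C₂ N M := by
  have hM' : (1 : ℝ) ≤ M := by exact_mod_cast hM
  have hB : 1 ≤ ((M : ℝ) + 2) / 2 := by linarith
  have h1 : √(N : ℝ) ≤ 2 ^ (N - 1) := by
    refine Real.sqrt_le_iff.mpr ⟨by positivity, ?_⟩
    have h : N ≤ (2 ^ (N - 1)) ^ 2 := by
      have := Nat.lt_two_pow_self (n := N - 1)
      exact (show N ≤ 2 ^ (N - 1) by omega).trans (Nat.le_self_pow two_ne_zero _)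
    exact_mod_cast h
  have h2 : ((((M : ℝ) + 2) / 2) ^ (N - 2)) ^ 2 ≤
      (((M : ℝ) + 2) / 2) ^ ((4 * (M : ℝ) + 1) * ((N : ℝ) - 2) / (2 * (M : ℝ))) := by
    rw [← pow_mul, ← Real.rpow_natCast]
    -- The exponents compare because `(4M + 1) / (2M) ≥ 2`.
    refine Real.rpow_le_rpow_of_exponent_le hB ?_
    rw [Nat.cast_mul, Nat.cast_sub hN, le_div_iff₀ (by positivity)]
    have : (2 : ℝ) ≤ N := by exact_mod_cast hN
    push_cast
    nlinarith
  have h3 : ((M + N - 2).choose (N - 2) : ℝ) ^ (1 / (2 * (M : ℝ))) ≤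
      ∏ j ∈ Finset.Icc 2 N, (((M + j - 2).choose (j - 2) : ℕ) : ℝ) ^ (1 / (2 * (M : ℝ))) := by
    rw [← Finset.mul_prod_erase _ _ (Finset.mem_Icc.mpr ⟨hN, le_rfl⟩)]
    refine le_mul_of_one_le_right (by positivity) (Finset.prod_induction _ (1 ≤ ·)
      (fun _ _ => one_le_mul_of_one_le_of_one_le) le_rfl fun j hj => ?_)
    have hj := (Finset.mem_Icc.mp (Finset.mem_of_mem_erase hj)).1
    refine Real.one_le_rpow ?_ (by positivity)
    exact_mod_cast Nat.choose_pos (by omega)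
  unfold C₂
  gcongr

end SmallZeros

open SmallZeros in
theorem theorem2 (Qbar : Type*) [Field Qbar] [CharZero Qbar] [IsAlgClosure ℚ Qbar]
    (K : Type*) [Field K] [NumberField K] [Algebra K Qbar]
    (N M : ℕ) (hN : 2 ≤ N) (hM : 1 ≤ M) (F : MvPolynomial (Fin N) K) (hF : F.IsHomogeneous M)
    (hne : ∀ i : Fin N, MvPolynomial.eval (Pi.single i (1 : K)) F ≠ 0) :
    ∃ z : Fin N → Qbar,
      SmallZeros.degOver K z ≤ M ∧ MvPolynomial.aeval z F = 0 ∧ (∀ i, z i ≠ 0) ∧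
      SmallZeros.absHeight z ≤
        SmallZeros.C₂ N M * SmallZeros.polyHeight F ^ (1 / (M : ℝ)) := by
  obtain ⟨i, j, hij⟩ : ∃ i j : Fin N, i ≠ j := ⟨⟨0, by omega⟩, ⟨1, by omega⟩, by simp⟩
  obtain ⟨β, hβ0, hβ, hg0⟩ := exists_eval_linePoly_ne_zero hN hF hij (hne i)
  have hFj : F.coeff (Finsupp.single j M) ≠ 0 := eval_single_one hF j ▸ hne j
  set g := linePoly F β j with hg
  have hgne : g ≠ 0 := fun h => hg0 (by simp [h])
  have : IsAlgClosed Qbar := IsAlgClosure.isAlgClosed ℚ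
  have : Algebra.IsAlgebraic K Qbar := Algebra.IsAlgebraic.tower_top (K := ℚ) K
  let L := IntermediateField.adjoin K (g.rootSet Qbar)
  have : FiniteDimensional K L :=
    IntermediateField.finiteDimensional_adjoin fun x _ => Algebra.IsIntegral.isIntegral x
  have : NumberField L := NumberField.of_module_finite K L
  have hsplit : (linePoly (MvPolynomial.map (algebraMap K L) F) β j).Splits := by
    have := IntermediateField.adjoin_rootSet_isSplittingField
      (IsAlgClosed.splits (g.map (algebraMap K Qbar)))
    rw [linePoly_map]
    exact Polynomial.IsSplittingField.splits L g
  have hF0 : F ≠ 0 := fun h => hFj (by simp [h])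
  obtain ⟨α, hα, hle⟩ := exists_isRoot_height_le hM (hF.map (algebraMap K L)) (by simpa using hN)
    hβ0 hβ (by
      rw [MvPolynomial.coeff_map]
      exact (map_ne_zero _).mpr hFj) hsplit
  rw [polyHeight_map _ hF0, Fintype.card_fin] at hle
  rw [linePoly_map] at hα
  have hgα : Polynomial.aeval α g = 0 := by
    rw [Polynomial.aeval_def, ← Polynomial.eval_map]
    exact hα
  have hα0 : α ≠ 0 := by
    rintro rfl
    refine hg0 ((algebraMap K L).injective ?_)
    rw [map_zero, ← Polynomial.aeval_algebraMap_apply_eq_algebraMap_eval, map_zero]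
    exact hgα
  set y : Fin N → L := fun i => (β i : L) * if i = j then α else 1 with hy
  have hy0 : ∀ i, y i ≠ 0 := fun i => by
    simp only [hy]
    split_ifs <;> simp [hα0, hβ0]
  refine ⟨fun i => (y i : Qbar), ?_, ?_, fun i => by simpa using hy0 i, ?_⟩
  -- The degree is bounded through `K(α)`, not through the possibly much larger splitting field `L`.
  · have hle : IntermediateField.adjoin K (Set.range fun i => (y i : Qbar)) ≤
        IntermediateField.adjoin K {(α : Qbar)} := by
      rw [IntermediateField.adjoin_le_iff]
      rintro _ ⟨i, rfl⟩
      have : (y i : Qbar) = (β i : Qbar) * if i = j then (α : Qbar) else 1 := by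
        simp only [hy]
        split_ifs <;> simp
      change (y i : Qbar) ∈ IntermediateField.adjoin K {(α : Qbar)}
      rw [this]
      refine mul_mem (intCast_mem _ _) ?_
      split_ifs
      · exact IntermediateField.mem_adjoin_simple_self K _
      · exact one_mem _
    have hint : IsIntegral K (α : Qbar) := Algebra.IsIntegral.isIntegral _
    have := IntermediateField.adjoin.finiteDimensional hint
    calc degOver K (fun i => (y i : Qbar))
        ≤ finrank K (IntermediateField.adjoin K {(α : Qbar)}) :=
          LinearMap.finrank_le_finrank_of_injective
            (f := (IntermediateField.inclusion hle).toLinearMap)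
            (IntermediateField.inclusion_injective hle)
      _ = (minpoly K (α : Qbar)).natDegree := IntermediateField.adjoin.finrank hint
      _ ≤ g.natDegree := Polynomial.natDegree_le_of_dvd (minpoly.dvd K _ (by
          rw [← IntermediateField.algebraMap_apply, Polynomial.aeval_algebraMap_apply, hgα,
            map_zero])) hgne
      _ ≤ M := natDegree_linePoly_le hF β j
  · have h := aeval_linePoly F β j α
    rw [← hg, hgα] at h
    have h2 := congrArg (algebraMap L Qbar) h
    rw [map_zero] at h2
    rw [h2]
    exact MvPolynomial.aeval_algebraMap_apply Qbar y F
  · refine le_trans (le_of_eq ?_) (hle.trans ?_)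
    · have hL : coordField (fun i => (y i : Qbar)) ≤ L.restrictScalars ℚ := by
        rw [IntermediateField.adjoin_le_iff]
        rintro _ ⟨i, rfl⟩
        exact (y i).2
      have := numberField_coordField fun i => (y i : Qbar)
      let f : coordField (fun i => (y i : Qbar)) →+* L := (IntermediateField.inclusion hL).toRingHom
      refine (height_ringHom f fun h => hy0 i ?_).symm
      exact Subtype.ext (Subtype.ext_iff.mp (congrFun h i) :)
    · have h := line_bound_le_C₂ hN hM
      exact mul_le_mul_of_nonneg_right h
        (Real.rpow_nonneg (Real.rpow_nonneg (relHeight_nonneg _) _) _)
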